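/- Let $k$ be a field and let $\Lambda$ be a finite-dimensional $k$-algebra with Jacobson radical $\mathfrak r$ and enveloping algebra $\Lambda^{e}=\Lambda\otimes_k\Lambda^{\mathrm{op}}$. Suppose that $\Lambda$ is symmetric, that is, $\Lambda\cong\operatorname{Hom}_k(\Lambda,k)$ as $\Lambda$-$\Lambda$-bimodules; that $\Lambda$ is periodic, that is, there is an integer $p>0$ with $\Lambda\cong\Omega^{p}_{\Lambda^{e}}(\Lambda)$ as left $\Lambda^{e}$-modules (bimodules), where $\Omega^{p}_{\Lambda^{e}}(\Lambda)$ denotes the $p$-th syzygy in a minimal projective resolution of $\Lambda$ over $\Lambda^{e}$; and that the ring $\Lambda/\mathfrak r\otimes_k\Lambda/\mathfrak r$ is semisimple. Then for all finitely generated left $\Lambda$-modules $M$ and $N$ the following are equivalent: (i) $\operatorname{Ext}^i_\Lambda(M,N)=0$ for $i\gg 0$; (ii) $\operatorname{Ext}^i_\Lambda(M,N)=0$ for all $i>0$; (iii) $\operatorname{Ext}^i_\Lambda(N,M)=0$ for $i\gg 0$; (iv) $\operatorname{Ext}^i_\Lambda(N,M)=0$ for all $i>0$. -/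

import Mathlib

open CategoryTheory
open scoped TensorProduct

universe u v

/-- `f : P → M` is a projective cover: `P` is projective, `f` is onto, and the kernel of `f` is a
superfluous submodule of `P`. -/
structure IsProjectiveCover {R : Type u} [Ring R] {P M : Type v} [AddCommGroup P] [Module R P]
    [AddCommGroup M] [Module R M] (f : P →ₗ[R] M) : Prop where
  projective : Module.Projective R P
  surjective : Function.Surjective f
  superfluous : ∀ S : Submodule R P, S ⊔ LinearMap.ker f = ⊤ → S = ⊤

/-- `IsMinimalSyzygy n M X`: the module `X` is (isomorphic to) the `n`-th syzygy `Ω^n M`, computed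
from a minimal projective resolution of `M`, that is, by taking `n` times in succession the kernel
of a projective cover. -/
def IsMinimalSyzygy {R : Type u} [Ring R] : ℕ → ModuleCat.{v} R → ModuleCat.{v} R → Prop
  | 0, M, X => Nonempty (X ≅ M)
  | n + 1, M, X => ∃ (P : ModuleCat.{v} R) (f : P →ₗ[R] M), IsProjectiveCover f ∧
      IsMinimalSyzygy n (ModuleCat.of R (LinearMap.ker f)) X

/-- `Λ` as a left module over its enveloping algebra `Λ ⊗ Λᵒᵖ`, where
`(a ⊗ b) • x = a * x * b`. -/
def regularBimodule (k : Type u) (Λ : Type v) [Field k] [Ring Λ] [Algebra k Λ] :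
    ModuleCat.{v} (Λ ⊗[k] Λᵐᵒᵖ) :=
  letI : Module (Λ ⊗[k] Λᵐᵒᵖ) Λ := TensorProduct.Algebra.module
  ModuleCat.of (Λ ⊗[k] Λᵐᵒᵖ) Λ

/-- `Λ` is periodic: `Λ ≅ Ω^p(Λ)` as bimodules for some `p > 0`. -/
def IsPeriodicAlgebra (k : Type u) (Λ : Type v) [Field k] [Ring Λ] [Algebra k Λ] : Prop :=
  ∃ p : ℕ, 0 < p ∧ IsMinimalSyzygy p (regularBimodule k Λ) (regularBimodule k Λ)

/-- `Λ` is symmetric: `Λ ≅ Hom_k(Λ, k)` as bimodules, where `(a • φ • b) x = φ (b * x * a)`. -/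
def IsSymmAlgebra (k : Type u) (Λ : Type v) [Field k] [Ring Λ] [Algebra k Λ] : Prop :=
  ∃ e : Λ ≃ₗ[k] Module.Dual k Λ, ∀ a b y x : Λ, e (a * y * b) x = e y (b * x * a)

/-!
A symmetrizing form `t` on `Λ` and a dual basis of a finitely generated projective module `Q` give
a trace on `End(Q)`, and the trace pairing identifies `Hom(M, Q)` with the `k`-dual of `Hom(Q, M)`.
Hence `Q` is injective. Moreover, if `Y` is the end of an exact sequence
`0 → X → Q₁ → ⋯ → Qₙ → Y → 0` of such modules, then `Hom(M, -)` and `Hom(-, M)` turn its middle part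
into complexes dual to each other, so that `Extⁱ(M, X)` and `Extʲ(Y, M)` vanish simultaneously
whenever `i, j > 0` and `i + j + 1 = n`.

A minimal resolution of `Λ` over `Λᵉ` splits as a sequence of left modules, so it stays exact under
`Hom_Λ(-, N)`, which sends finitely generated projective bimodules to finitely generated projective
modules (the symmetrizing form embodies `Hom_Λ(Λᵉ, N) ≅ Λ ⊗ N`). Periodicity therefore makes `N` the
`p`-th cosyzygy of itself. Splicing, `n` can be chosen arbitrarily large with `X = Y = N`, which
yields both the passage from `i ≫ 0` to `i > 0` and the symmetry in `M` and `N`.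
-/

section SymmetrizingForm

variable {k Λ : Type*} [CommRing k] [Ring Λ] [Algebra k Λ] {t : Λ →ₗ[k] k}

/-- A symmetrizing form: a trace form `t` on `Λ` for which `a ↦ t(· * a)` identifies `Λ` with its
`k`-linear dual. -/
structure IsSymmetrizingForm (t : Λ →ₗ[k] k) : Prop where
  mul_comm (a b : Λ) : t (a * b) = t (b * a)
  bijective : Function.Bijective fun a : Λ => t ∘ₗ LinearMap.mulRight k a

theorem IsSymmAlgebra.exists_isSymmetrizingForm {k : Type u} {Λ : Type v} [Field k] [Ring Λ]
    [Algebra k Λ] (h : IsSymmAlgebra k Λ) : ∃ t : Λ →ₗ[k] k, IsSymmetrizingForm t := by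
  obtain ⟨e, he⟩ := h
  have apply_eq_mul_right (a x : Λ) : e a x = e 1 (x * a) := by simpa using he a 1 1 x
  have apply_eq_mul_left (a x : Λ) : e a x = e 1 (a * x) := by simpa using he 1 a 1 x
  refine ⟨e 1, fun a b => by rw [← apply_eq_mul_right, apply_eq_mul_left], ?_⟩
  convert e.bijective using 2 with a
  exact LinearMap.ext fun x => (apply_eq_mul_right a x).symm

namespace IsSymmetrizingForm

theorem ext (ht : IsSymmetrizingForm t) {a b : Λ} (h : ∀ x, t (x * a) = t (x * b)) : a = b :=
  ht.bijective.injective (LinearMap.ext h)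

theorem exists_apply_mul_eq (ht : IsSymmetrizingForm t) (φ : Module.Dual k Λ) :
    ∃ a, ∀ x, t (x * a) = φ x := by
  obtain ⟨a, ha⟩ := ht.bijective.surjective φ
  exact ⟨a, LinearMap.congr_fun ha⟩

variable {X : Type*} [AddCommGroup X] [Module k X] [Module Λ X] [IsScalarTower k Λ X]

theorem comp_bijective (ht : IsSymmetrizingForm t) :
    Function.Bijective fun f : X →ₗ[Λ] Λ => t ∘ₗ f.restrictScalars k := by
  constructor
  · refine fun f g h => LinearMap.ext fun x => ht.ext fun a => ?_
    have := LinearMap.congr_fun h (a • x)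
    simpa using this
  · intro φ
    choose f hf using fun x : X =>
      ht.exists_apply_mul_eq (φ ∘ₗ (LinearMap.toSpanSingleton Λ X x).restrictScalars k)
    simp only [LinearMap.comp_apply, LinearMap.restrictScalars_apply,
      LinearMap.toSpanSingleton_apply] at hf
    refine ⟨⟨⟨f, fun x y => ht.ext fun a => ?_⟩, fun b x => ht.ext fun a => ?_⟩,
      LinearMap.ext fun x => by simpa using hf x 1⟩
    · rw [mul_add, map_add, hf, hf, hf, smul_add, map_add]
    · rw [RingHom.id_apply, smul_eq_mul, ← mul_assoc, hf, hf, mul_smul]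

end IsSymmetrizingForm

end SymmetrizingForm

section Trace

/-- A finite dual basis of the `R`-module `Q`: vectors and coordinate functionals, indexed by `ι`,
through which the identity of `Q` factors. It witnesses that `Q` is finitely generated and
projective. -/
structure FiniteDualBasis (ι R Q : Type*) [Fintype ι] [Semiring R] [AddCommMonoid Q]
    [Module R Q] where
  vec : ι → Q
  coord : ι → Q →ₗ[R] R
  sum_coord_smul_vec (x : Q) : ∑ i, coord i x • vec i = x

namespace FiniteDualBasis

theorem exists_of_finite_projective (R Q : Type*) [Semiring R] [AddCommMonoid Q] [Module R Q]
    [Module.Finite R Q] [Module.Projective R Q] :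
    ∃ n : ℕ, Nonempty (FiniteDualBasis (Fin n) R Q) := by
  obtain ⟨n, r, s, -, -, hrs⟩ := Module.Finite.exists_comp_eq_id_of_projective R Q
  refine ⟨n, ⟨⟨fun i => r (Pi.single i 1), fun i => LinearMap.proj i ∘ₗ s, fun x => ?_⟩⟩⟩
  calc ∑ i, s x i • r (Pi.single i 1) = r (∑ i, s x i • Pi.single i 1) := by
        simp only [map_sum, map_smul]
    _ = x := by rw [← pi_eq_sum_univ' (s x)]; exact LinearMap.congr_fun hrs x

variable {k Λ ι κ Q Q' : Type*} [CommRing k] [Ring Λ] [Algebra k Λ] [Fintype ι] [Fintype κ]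
  [AddCommGroup Q] [Module Λ Q] [AddCommGroup Q'] [Module Λ Q']

/-- The trace of an endomorphism with respect to a dual basis and a linear form `t` on `Λ`,
generalizing `t` itself (`Q = Λ`) and the trace of a matrix (`t = id`). -/
def trace (B : FiniteDualBasis ι Λ Q) (t : Λ →ₗ[k] k) (h : Q →ₗ[Λ] Q) : k :=
  ∑ i, t (B.coord i (h (B.vec i)))

theorem apply_eq_sum (B : FiniteDualBasis ι Λ Q) (f : Q →ₗ[Λ] Q') (x : Q) :
    f x = ∑ i, B.coord i x • f (B.vec i) := by
  conv_lhs => rw [← B.sum_coord_smul_vec x, map_sum]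
  simp only [map_smul]

theorem trace_comp_comm {t : Λ →ₗ[k] k} (ht : ∀ a b, t (a * b) = t (b * a))
    (B : FiniteDualBasis ι Λ Q) (B' : FiniteDualBasis κ Λ Q') (u : Q →ₗ[Λ] Q')
    (v : Q' →ₗ[Λ] Q) : B.trace t (v ∘ₗ u) = B'.trace t (u ∘ₗ v) := by
  calc ∑ i, t (B.coord i (v (u (B.vec i))))
      = ∑ i, ∑ j, t (B'.coord j (u (B.vec i)) * B.coord i (v (B'.vec j))) := by
        refine Finset.sum_congr rfl fun i _ => ?_
        simp only [B'.apply_eq_sum v (u _), map_sum, map_smul, smul_eq_mul]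
    _ = ∑ j, ∑ i, t (B.coord i (v (B'.vec j)) * B'.coord j (u (B.vec i))) := by
        rw [Finset.sum_comm]
        simp only [ht]
    _ = ∑ j, t (B'.coord j (u (v (B'.vec j)))) := by
        refine Finset.sum_congr rfl fun j _ => ?_
        simp only [B.apply_eq_sum u (v _), map_sum, map_smul, smul_eq_mul]

theorem trace_smulRight {t : Λ →ₗ[k] k} (ht : ∀ a b, t (a * b) = t (b * a))
    (B : FiniteDualBasis ι Λ Q) (u : Q →ₗ[Λ] Λ) (x : Q) :
    B.trace t (u.smulRight x) = t (u x) := by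
  conv_rhs => rw [← B.sum_coord_smul_vec x]
  simp only [trace, LinearMap.smulRight_apply, map_smul, smul_eq_mul, ht (u _), map_sum]

section Pairing

variable [Module k Q] [IsScalarTower k Λ Q] (B : FiniteDualBasis ι Λ Q) (t : Λ →ₗ[k] k)
  (M : Type*) [AddCommGroup M] [Module k M] [Module Λ M] [IsScalarTower k Λ M]

/-- The trace pairing `⟨g, f⟩ = tr (g ∘ f)` between maps into and maps out of `Q`. -/
def tracePairing : (M →ₗ[Λ] Q) →ₗ[k] Module.Dual k (Q →ₗ[Λ] M) :=
  LinearMap.mk₂ k (fun g f => B.trace t (g ∘ₗ f))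
    (fun _ _ _ => by simp [trace, Finset.sum_add_distrib])
    (fun _ _ _ => by simp [trace, Finset.mul_sum, LinearMap.map_smul_of_tower])
    (fun _ _ _ => by simp [trace, Finset.sum_add_distrib])
    (fun _ _ _ => by simp [trace, Finset.mul_sum, LinearMap.map_smul_of_tower])

variable {M t}

theorem tracePairing_apply (g : M →ₗ[Λ] Q) (f : Q →ₗ[Λ] M) :
    B.tracePairing t M g f = B.trace t (g ∘ₗ f) := rfl

theorem tracePairing_smulRight (ht : ∀ a b, t (a * b) = t (b * a)) (g : M →ₗ[Λ] Q)
    (u : Q →ₗ[Λ] Λ) (x : M) : B.tracePairing t M g (u.smulRight x) = t (u (g x)) := by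
  rw [tracePairing_apply, ← B.trace_smulRight ht]
  congr 1
  ext y
  simp

theorem tracePairing_injective (ht : IsSymmetrizingForm t) :
    Function.Injective (B.tracePairing t M) := by
  refine (injective_iff_map_eq_zero _).2 fun g hg => LinearMap.ext fun x => ?_
  rw [LinearMap.zero_apply, ← B.sum_coord_smul_vec (g x)]
  refine Finset.sum_eq_zero fun i _ => ?_
  have coord_eq_zero : B.coord i (g x) = 0 := ht.ext fun a => by
    have := LinearMap.congr_fun hg ((B.coord i).smulRight (a • x))
    rw [B.tracePairing_smulRight ht.mul_comm] at this
    simpa using this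
  rw [coord_eq_zero, zero_smul]

theorem tracePairing_surjective (ht : IsSymmetrizingForm t) :
    Function.Surjective (B.tracePairing t M) := by
  intro ξ
  choose g hg using fun i => ht.comp_bijective.surjective
    (ξ ∘ₗ LinearMap.lcomp k M (B.coord i) ∘ₗ (LinearMap.ringLmapEquivSelf Λ k M).symm.toLinearMap)
  have apply_g (i : ι) (x : M) : t (g i x) = ξ ((B.coord i).smulRight x) :=
    (LinearMap.congr_fun (hg i) x).trans (congrArg ξ (LinearMap.ext fun _ => rfl))
  refine ⟨∑ i, (g i).smulRight (B.vec i), LinearMap.ext fun f => ?_⟩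
  calc B.tracePairing t M (∑ i, (g i).smulRight (B.vec i)) f
      = ∑ i, B.trace t ((g i ∘ₗ f).smulRight (B.vec i)) := by
        rw [map_sum, LinearMap.sum_apply]; rfl
    _ = ∑ i, ξ ((B.coord i).smulRight (f (B.vec i))) := by
        simp only [B.trace_smulRight ht.mul_comm, LinearMap.comp_apply, apply_g]
    _ = ξ f := by
        rw [← map_sum]
        congr 1
        ext x
        simpa using (B.apply_eq_sum f x).symm

theorem tracePairing_bijective (ht : IsSymmetrizingForm t) :
    Function.Bijective (B.tracePairing t M) :=
  ⟨B.tracePairing_injective ht, B.tracePairing_surjective ht⟩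

end Pairing
end FiniteDualBasis

end Trace

section SelfInjective

theorem exact_dualMap_iff {k V₁ V₂ V₃ : Type*} [Field k] [AddCommGroup V₁] [Module k V₁]
    [AddCommGroup V₂] [Module k V₂] [AddCommGroup V₃] [Module k V₃] {f : V₁ →ₗ[k] V₂}
    {g : V₂ →ₗ[k] V₃} : Function.Exact g.dualMap f.dualMap ↔ Function.Exact f g := by
  rw [LinearMap.exact_iff, LinearMap.exact_iff, LinearMap.ker_dualMap_eq_dualAnnihilator_range,
    LinearMap.range_dualMap_eq_dualAnnihilator_ker, Subspace.dualAnnihilator_inj, eq_comm]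

namespace IsSymmetrizingForm

variable {k Λ : Type*} [Field k] [Ring Λ] [Algebra k Λ] {t : Λ →ₗ[k] k}

theorem exists_extension (ht : IsSymmetrizingForm t) {Q X Y : Type*}
    [AddCommGroup Q] [Module k Q] [Module Λ Q] [IsScalarTower k Λ Q] [Module.Finite Λ Q]
    [Module.Projective Λ Q] [AddCommGroup X] [Module k X] [Module Λ X] [IsScalarTower k Λ X]
    [AddCommGroup Y] [Module k Y] [Module Λ Y] [IsScalarTower k Λ Y]
    (i : X →ₗ[Λ] Y) (hi : Function.Injective i) (f : X →ₗ[Λ] Q) :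
    ∃ g : Y →ₗ[Λ] Q, g ∘ₗ i = f := by
  obtain ⟨n, ⟨B⟩⟩ := FiniteDualBasis.exists_of_finite_projective Λ Q
  obtain ⟨η, hη⟩ := LinearMap.dualMap_surjective_of_injective
    (f := LinearMap.compRight k (M := Q) i)
    (fun _ _ h => LinearMap.ext fun x => hi (LinearMap.congr_fun h x)) (B.tracePairing t X f)
  obtain ⟨g, rfl⟩ := B.tracePairing_surjective ht η
  exact ⟨g, B.tracePairing_injective ht hη⟩

end IsSymmetrizingForm

end SelfInjective

section ExtShift

open Abelian

variable {C : Type*} [Category* C] [Abelian C] {S : ShortComplex C}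

theorem forall_lift_iff_exact (hS : S.ShortExact) {P I : C} (p : P ⟶ S.X₁) (i : S.X₃ ⟶ I) [Mono i]
    (M : C) : (∀ f : M ⟶ S.X₁, ∃ g, g ≫ p = f) ↔
      Function.Exact (fun g : M ⟶ P => g ≫ p ≫ S.f) (fun g : M ⟶ S.X₂ => g ≫ S.g ≫ i) := by
  have := hS.mono_f
  refine ⟨fun lifts y => ⟨fun hy => ?_, ?_⟩, fun exact f => ?_⟩
  · have hy' : y ≫ S.g = 0 := by rwa [← cancel_mono i, Category.assoc, Limits.zero_comp]
    obtain ⟨g, hg⟩ := lifts (hS.exact.lift y hy')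
    exact ⟨g, by simp [reassoc_of% hg]⟩
  · rintro ⟨g, rfl⟩
    simp
  · obtain ⟨g, hg⟩ := (exact (f ≫ S.f)).1 (by simp)
    exact ⟨g, by simpa [← cancel_mono S.f] using hg⟩

theorem forall_desc_iff_exact (hS : S.ShortExact) {P I : C} (p : P ⟶ S.X₁) (i : S.X₃ ⟶ I) [Epi p]
    (M : C) : (∀ f : S.X₃ ⟶ M, ∃ g, i ≫ g = f) ↔
      Function.Exact (fun g : I ⟶ M => (S.g ≫ i) ≫ g) (fun g : S.X₂ ⟶ M => (p ≫ S.f) ≫ g) := by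
  have := hS.epi_g
  refine ⟨fun extends_ y => ⟨fun hy => ?_, ?_⟩, fun exact f => ?_⟩
  · have hy' : S.f ≫ y = 0 := by rwa [← cancel_epi p, ← Category.assoc, Limits.comp_zero]
    obtain ⟨g, hg⟩ := extends_ (hS.exact.desc y hy')
    exact ⟨g, by simp [hg]⟩
  · rintro ⟨g, rfl⟩
    simp
  · obtain ⟨g, hg⟩ := (exact (S.g ≫ f)).1 (by simp)
    exact ⟨g, by simpa [← cancel_epi S.g] using hg⟩

variable [HasExt C]

theorem subsingleton_ext_X₃_add_two_iff (hS : S.ShortExact) [Projective S.X₂] (Y : C) (n : ℕ) :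
    Subsingleton (Ext S.X₃ Y (n + 2)) ↔ Subsingleton (Ext S.X₁ Y (n + 1)) := by
  have bijective : Function.Bijective
      (hS.extClass.precomp Y (add_comm 1 (n + 1)) : Ext S.X₁ Y (n + 1) →+ Ext S.X₃ Y (n + 2)) := by
    refine ⟨(injective_iff_map_eq_zero _).2 fun x hx => ?_, fun x => ?_⟩
    · obtain ⟨y, rfl⟩ := Ext.contravariant_sequence_exact₁ hS Y x (add_comm 1 (n + 1)) hx
      rw [Ext.eq_zero_of_projective y, Ext.comp_zero]
    · exact Ext.contravariant_sequence_exact₃ hS Y x (Ext.eq_zero_of_projective _)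
        (add_comm 1 (n + 1))
  exact (Equiv.ofBijective _ bijective).symm.subsingleton_congr

theorem subsingleton_ext_X₃_one_iff (hS : S.ShortExact) [Projective S.X₂] (Y : C) :
    Subsingleton (Ext S.X₃ Y 1) ↔ ∀ f : S.X₁ ⟶ Y, ∃ g : S.X₂ ⟶ Y, S.f ≫ g = f := by
  constructor
  · intro _ f
    obtain ⟨x, hx⟩ := Ext.contravariant_sequence_exact₁ hS Y (Ext.mk₀ f) (add_zero 1)
      (Subsingleton.elim _ _)
    obtain ⟨g, rfl⟩ := (Ext.mk₀_bijective _ _).surjective x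
    exact ⟨g, (Ext.mk₀_bijective _ _).injective (by rw [← Ext.mk₀_comp_mk₀, hx])⟩
  · refine fun extends_ => subsingleton_of_forall_eq 0 fun x => ?_
    obtain ⟨y, rfl⟩ := Ext.contravariant_sequence_exact₃ hS Y x (Ext.eq_zero_of_projective _)
      (add_zero 1)
    obtain ⟨f, rfl⟩ := (Ext.mk₀_bijective _ _).surjective y
    obtain ⟨g, rfl⟩ := extends_ f
    rw [← Ext.mk₀_comp_mk₀, hS.extClass_comp_assoc]

theorem subsingleton_ext_X₁_add_two_iff (hS : S.ShortExact) [Injective S.X₂] (Y : C) (n : ℕ) :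
    Subsingleton (Ext Y S.X₁ (n + 2)) ↔ Subsingleton (Ext Y S.X₃ (n + 1)) := by
  have bijective : Function.Bijective
      (hS.extClass.postcomp Y rfl : Ext Y S.X₃ (n + 1) →+ Ext Y S.X₁ (n + 2)) := by
    refine ⟨(injective_iff_map_eq_zero _).2 fun x hx => ?_, fun x => ?_⟩
    · obtain ⟨y, rfl⟩ := Ext.covariant_sequence_exact₃ Y hS x rfl hx
      rw [Ext.eq_zero_of_injective y, Ext.zero_comp]
    · exact Ext.covariant_sequence_exact₁ Y hS x (Ext.eq_zero_of_injective _) rfl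
  exact (Equiv.ofBijective _ bijective).symm.subsingleton_congr

theorem subsingleton_ext_X₁_one_iff (hS : S.ShortExact) [Injective S.X₂] (Y : C) :
    Subsingleton (Ext Y S.X₁ 1) ↔ ∀ f : Y ⟶ S.X₃, ∃ g : Y ⟶ S.X₂, g ≫ S.g = f := by
  constructor
  · intro _ f
    obtain ⟨x, hx⟩ := Ext.covariant_sequence_exact₃ Y hS (Ext.mk₀ f) (zero_add 1)
      (Subsingleton.elim _ _)
    obtain ⟨g, rfl⟩ := (Ext.mk₀_bijective _ _).surjective x
    exact ⟨g, (Ext.mk₀_bijective _ _).injective (by rw [← Ext.mk₀_comp_mk₀, hx])⟩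
  · refine fun lifts => subsingleton_of_forall_eq 0 fun x => ?_
    obtain ⟨y, rfl⟩ := Ext.covariant_sequence_exact₁ Y hS x (Ext.eq_zero_of_injective _)
      (zero_add 1)
    obtain ⟨f, rfl⟩ := (Ext.mk₀_bijective _ _).surjective y
    obtain ⟨g, rfl⟩ := lifts f
    rw [← Ext.mk₀_comp_mk₀, Ext.comp_assoc_of_second_deg_zero, hS.comp_extClass, Ext.comp_zero]

end ExtShift

section Cosyzygy

/-- `IsCosyzygy n X Y`: the module `Y` is an `n`-th cosyzygy of `X`, that is, there is an exact
sequence `0 → X → Q₁ → ⋯ → Qₙ → Y → 0` with all `Qᵢ` finitely generated projective. Over a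
symmetric algebra the `Qᵢ` are also injective. -/
def IsCosyzygy {R : Type u} [Ring R] : ℕ → ModuleCat.{v} R → ModuleCat.{v} R → Prop
  | 0, X, Y => Nonempty (X ≅ Y)
  | n + 1, X, Y => ∃ (Q Z : ModuleCat.{v} R) (i : X ⟶ Q) (q : Q ⟶ Z) (w : i ≫ q = 0),
      Module.Finite R Q ∧ Module.Projective R Q ∧ (ShortComplex.mk i q w).ShortExact ∧
        IsCosyzygy n Z Y

namespace IsCosyzygy

variable {R : Type u} [Ring R] {X Y Z : ModuleCat.{v} R} {m n : ℕ}

theorem of_iso_right (h : IsCosyzygy n X Y) (e : Y ≅ Z) : IsCosyzygy n X Z := by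
  induction n generalizing X with
  | zero => exact h.map (·.trans e)
  | succ n ih =>
    obtain ⟨Q, V, i, q, w, finite, projective, hS, h⟩ := h
    exact ⟨Q, V, i, q, w, finite, projective, hS, ih h⟩

theorem of_iso_left (e : Z ≅ X) (h : IsCosyzygy n X Y) : IsCosyzygy n Z Y := by
  cases n with
  | zero => exact h.map e.trans
  | succ n =>
    obtain ⟨Q, V, i, q, w, finite, projective, hS, h⟩ := h
    have w' : (e.hom ≫ i) ≫ q = 0 := by simp [w]
    let iso : ShortComplex.mk (e.hom ≫ i) q w' ≅ ShortComplex.mk i q w :=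
      ShortComplex.isoMk e (Iso.refl Q) (Iso.refl V)
    exact ⟨Q, V, e.hom ≫ i, q, w', finite, projective,
      (ShortComplex.shortExact_iff_of_iso iso).2 hS, h⟩

theorem trans (hXY : IsCosyzygy m X Y) (hYZ : IsCosyzygy n Y Z) : IsCosyzygy (m + n) X Z := by
  induction m generalizing X with
  | zero =>
    obtain ⟨e⟩ := hXY
    rw [zero_add]
    exact hYZ.of_iso_left e
  | succ m ih =>
    obtain ⟨Q, V, i, q, w, finite, projective, hS, h⟩ := hXY
    exact Nat.succ_add m n ▸ ⟨Q, V, i, q, w, finite, projective, hS, ih h⟩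

theorem exists_of_add (h : IsCosyzygy (m + n) X Z) :
    ∃ Y, IsCosyzygy m X Y ∧ IsCosyzygy n Y Z := by
  induction m generalizing X with
  | zero => exact ⟨X, ⟨Iso.refl X⟩, zero_add n ▸ h⟩
  | succ m ih =>
    obtain ⟨Q, V, i, q, w, finite, projective, hS, h⟩ := Nat.succ_add m n ▸ h
    obtain ⟨Y, hY, hYZ⟩ := ih h
    exact ⟨Y, ⟨Q, V, i, q, w, finite, projective, hS, hY⟩, hYZ⟩

theorem self_mul (h : IsCosyzygy n X X) (m : ℕ) : IsCosyzygy (m * n) X X := by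
  induction m with
  | zero =>
    rw [zero_mul]
    exact ⟨Iso.refl X⟩
  | succ m ih => exact Nat.succ_mul m n ▸ ih.trans h

end IsCosyzygy
end Cosyzygy

section TateDuality

open Abelian
open scoped ModuleCat

theorem subsingleton_ext_iff_of_iso_left {C : Type*} [Category* C] [Abelian C] [HasExt C]
    {X Y : C} (e : X ≅ Y) (M : C) (n : ℕ) :
    Subsingleton (Ext X M n) ↔ Subsingleton (Ext Y M n) :=
  (((extFunctor n).mapIso e.op).app M).addCommGroupIsoToAddEquiv.subsingleton_congr.symm

theorem subsingleton_ext_iff_of_iso_right {C : Type*} [Category* C] [Abelian C] [HasExt C]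
    {X Y : C} (e : X ≅ Y) (M : C) (n : ℕ) :
    Subsingleton (Ext M X n) ↔ Subsingleton (Ext M Y n) :=
  ((extFunctorObj M n).mapIso e).addCommGroupIsoToAddEquiv.subsingleton_congr

theorem IsCosyzygy.subsingleton_ext_iff_shift_left {R : Type u} [Ring R] [Small.{v} R]
    {X Y : ModuleCat.{v} R} {n : ℕ} (h : IsCosyzygy n X Y) (M : ModuleCat.{v} R) (i : ℕ) :
    Subsingleton (Ext X M (i + 1)) ↔ Subsingleton (Ext Y M (n + i + 1)) := by
  induction n generalizing X i with
  | zero =>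
    obtain ⟨e⟩ := h
    rw [zero_add]
    exact subsingleton_ext_iff_of_iso_left e M _
  | succ n ih =>
    obtain ⟨Q, V, f, q, w, _, _, hS, h⟩ := h
    have : Projective (ShortComplex.mk f q w).X₂ := inferInstanceAs (Projective Q)
    rw [Nat.succ_add n i, ← Nat.add_succ n i, ← ih h (i + 1)]
    exact (subsingleton_ext_X₃_add_two_iff hS M i).symm

variable {k : Type u} {Λ : Type v} [Field k] [Ring Λ] [Algebra k Λ] {t : Λ →ₗ[k] k}

/-- The perfect trace pairing `⟨g, f⟩ = tr (f ≫ g)` between `Hom(M, Q)` and `Hom(Q, M)`. -/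
noncomputable def FiniteDualBasis.homEquivDual {ι : Type*} [Fintype ι] {Q : ModuleCat.{v} Λ}
    (B : FiniteDualBasis ι Λ Q) (ht : IsSymmetrizingForm t) (M : ModuleCat.{v} Λ) :
    (M ⟶ Q) ≃ₗ[k] Module.Dual k (Q ⟶ M) :=
  ModuleCat.homLinearEquiv ≪≫ₗ .ofBijective _ (B.tracePairing_bijective ht) ≪≫ₗ
    ModuleCat.homLinearEquiv.dualMap

namespace IsSymmetrizingForm

theorem injective_of_finite_projective (ht : IsSymmetrizingForm t) (Q : ModuleCat.{v} Λ)
    [Module.Finite Λ Q] [Module.Projective Λ Q] : Injective Q where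
  factors {X Y} f i _ := by
    obtain ⟨g, hg⟩ := ht.exists_extension i.hom ((ModuleCat.mono_iff_injective i).1 ‹_›) f.hom
    exact ⟨ModuleCat.ofHom g, ModuleCat.hom_ext hg⟩

theorem exact_comp_right_iff_exact_comp_left (ht : IsSymmetrizingForm t)
    {Q₀ Q₁ Q₂ : ModuleCat.{v} Λ} [Module.Finite Λ Q₀] [Module.Projective Λ Q₀]
    [Module.Finite Λ Q₁] [Module.Projective Λ Q₁] [Module.Finite Λ Q₂] [Module.Projective Λ Q₂]
    (a : Q₀ ⟶ Q₁) (b : Q₁ ⟶ Q₂) (M : ModuleCat.{v} Λ) :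
    Function.Exact (fun g : M ⟶ Q₀ => g ≫ a) (fun g : M ⟶ Q₁ => g ≫ b) ↔
      Function.Exact (fun f : Q₂ ⟶ M => b ≫ f) (fun f : Q₁ ⟶ M => a ≫ f) := by
  obtain ⟨_, ⟨B₀⟩⟩ := FiniteDualBasis.exists_of_finite_projective Λ Q₀
  obtain ⟨_, ⟨B₁⟩⟩ := FiniteDualBasis.exists_of_finite_projective Λ Q₁
  obtain ⟨_, ⟨B₂⟩⟩ := FiniteDualBasis.exists_of_finite_projective Λ Q₂
  let E₀ := B₀.homEquivDual ht M
  let E₁ := B₁.homEquivDual ht M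
  let E₂ := B₂.homEquivDual ht M
  refine Iff.trans (Function.Exact.iff_of_ladder_linearEquiv
    (f₁₂ := Linear.rightComp k M a) (f₂₃ := Linear.rightComp k M b)
    (g₁₂ := (Linear.leftComp k M a).dualMap) (g₂₃ := (Linear.leftComp k M b).dualMap)
    (e₁ := E₀) (e₂ := E₁) (e₃ := E₂)
    (LinearMap.ext fun g => LinearMap.ext fun f => ?_)
    (LinearMap.ext fun g => LinearMap.ext fun f => ?_)).symm
    (exact_dualMap_iff (f := Linear.leftComp k M b))
  · exact B₀.trace_comp_comm ht.mul_comm B₁ a.hom (g.hom ∘ₗ f.hom)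
  · exact B₁.trace_comp_comm ht.mul_comm B₂ b.hom (g.hom ∘ₗ f.hom)

theorem subsingleton_ext_one_iff (ht : IsSymmetrizingForm t) {X Y : ModuleCat.{v} Λ}
    (h : IsCosyzygy 3 X Y) (M : ModuleCat.{v} Λ) :
    Subsingleton (Ext M X 1) ↔ Subsingleton (Ext Y M 1) := by
  obtain ⟨Q₀, B, i₀, q₀, w₀, _, _, hS₀, Q₁, C, i₁, q₁, w₁, _, _, hS₁,
    Q₂, D, i₂, q₂, w₂, _, _, hS₂, ⟨e⟩⟩ := h
  have : Injective (ShortComplex.mk i₀ q₀ w₀).X₂ := ht.injective_of_finite_projective Q₀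
  have : Projective (ShortComplex.mk i₂ q₂ w₂).X₂ := inferInstanceAs (Projective Q₂)
  have : Epi q₀ := hS₀.epi_g
  have : Mono i₂ := hS₂.mono_f
  calc Subsingleton (Ext M X 1)
      ↔ ∀ f : M ⟶ B, ∃ g, g ≫ q₀ = f := subsingleton_ext_X₁_one_iff hS₀ M
    _ ↔ _ := forall_lift_iff_exact hS₁ q₀ i₂ M
    _ ↔ _ := ht.exact_comp_right_iff_exact_comp_left _ _ M
    _ ↔ ∀ f : C ⟶ M, ∃ g, i₂ ≫ g = f := (forall_desc_iff_exact hS₁ q₀ i₂ M).symm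
    _ ↔ Subsingleton (Ext D M 1) := (subsingleton_ext_X₃_one_iff hS₂ M).symm
    _ ↔ Subsingleton (Ext Y M 1) := subsingleton_ext_iff_of_iso_left e M 1

theorem subsingleton_ext_iff_shift_right (ht : IsSymmetrizingForm t) {X Y : ModuleCat.{v} Λ}
    {n : ℕ} (h : IsCosyzygy n X Y) (M : ModuleCat.{v} Λ) (i : ℕ) :
    Subsingleton (Ext M X (n + i + 1)) ↔ Subsingleton (Ext M Y (i + 1)) := by
  induction n generalizing X with
  | zero =>
    obtain ⟨e⟩ := h
    rw [zero_add]
    exact subsingleton_ext_iff_of_iso_right e M _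
  | succ n ih =>
    obtain ⟨Q, V, f, q, w, _, _, hS, h⟩ := h
    have : Injective (ShortComplex.mk f q w).X₂ := ht.injective_of_finite_projective Q
    rw [Nat.succ_add, ← ih h]
    exact subsingleton_ext_X₁_add_two_iff hS M (n + i)

theorem subsingleton_ext_iff_of_isCosyzygy_add_three (ht : IsSymmetrizingForm t)
    {X Y : ModuleCat.{v} Λ} {i j : ℕ} (h : IsCosyzygy (i + 3 + j) X Y) (M : ModuleCat.{v} Λ) :
    Subsingleton (Ext M X (i + 1)) ↔ Subsingleton (Ext Y M (j + 1)) := by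
  obtain ⟨V, hXV, hVY⟩ := h.exists_of_add
  obtain ⟨U, hXU, hUV⟩ := hXV.exists_of_add
  rw [← add_zero i, ht.subsingleton_ext_iff_shift_right hXU,
    ht.subsingleton_ext_one_iff hUV, hVY.subsingleton_ext_iff_shift_left M 0]

theorem tfae_subsingleton_ext (ht : IsSymmetrizingForm t) {N : ModuleCat.{v} Λ} {p : ℕ}
    (hp : 0 < p) (hN : IsCosyzygy p N N) (M : ModuleCat.{v} Λ) :
    List.TFAE [
      ∃ n : ℕ, ∀ i : ℕ, n ≤ i → Subsingleton (Ext M N i),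
      ∀ i : ℕ, 0 < i → Subsingleton (Ext M N i),
      ∃ n : ℕ, ∀ i : ℕ, n ≤ i → Subsingleton (Ext N M i),
      ∀ i : ℕ, 0 < i → Subsingleton (Ext N M i)] := by
  have exists_isCosyzygy (n : ℕ) : ∃ m, n ≤ m ∧ IsCosyzygy m N N :=
    ⟨n * p, Nat.le_mul_of_pos_right n hp, hN.self_mul n⟩
  tfae_have 2 → 1 := fun h => ⟨1, h⟩
  tfae_have 4 → 3 := fun h => ⟨1, h⟩
  tfae_have 1 → 2 := by
    rintro ⟨n, hn⟩ (_ | i) hi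
    · exact absurd hi (lt_irrefl 0)
    · obtain ⟨m, hnm, hm⟩ := exists_isCosyzygy n
      exact (ht.subsingleton_ext_iff_shift_right hm M i).1 (hn _ (by lia))
  tfae_have 3 → 4 := by
    rintro ⟨n, hn⟩ (_ | i) hi
    · exact absurd hi (lt_irrefl 0)
    · obtain ⟨m, hnm, hm⟩ := exists_isCosyzygy n
      exact (hm.subsingleton_ext_iff_shift_left M i).2 (hn _ (by lia))
  tfae_have 2 → 4 := by
    rintro h (_ | j) hj
    · exact absurd hj (lt_irrefl 0)
    · obtain ⟨m, hm_ge, hm⟩ := exists_isCosyzygy (3 + j)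
      obtain ⟨i, rfl⟩ := exists_add_of_le hm_ge
      rw [show 3 + j + i = i + 3 + j by ring] at hm
      exact (ht.subsingleton_ext_iff_of_isCosyzygy_add_three hm M).1 (h _ i.succ_pos)
  tfae_have 4 → 2 := by
    rintro h (_ | i) hi
    · exact absurd hi (lt_irrefl 0)
    · obtain ⟨m, hm_ge, hm⟩ := exists_isCosyzygy (i + 3)
      obtain ⟨j, rfl⟩ := exists_add_of_le hm_ge
      exact (ht.subsingleton_ext_iff_of_isCosyzygy_add_three hm M).2 (h _ j.succ_pos)
  tfae_finish

end IsSymmetrizingForm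

end TateDuality

section Bimodule

/-- The `Λ ⊗ Λᵒᵖ`-module `P` regarded as a bimodule: a left module over `Λ` and, through the right
action, over `Λᵐᵒᵖ`. -/
def AsBimodule (_k _Λ P : Type*) : Type _ := P

namespace AsBimodule

variable {k Λ P L : Type*} [CommRing k] [Ring Λ] [Algebra k Λ] [AddCommGroup P]
  [Module (Λ ⊗[k] Λᵐᵒᵖ) P] [AddCommGroup L] [Module (Λ ⊗[k] Λᵐᵒᵖ) L]

instance : AddCommGroup (AsBimodule k Λ P) := inferInstanceAs (AddCommGroup P)

instance : Module Λ (AsBimodule k Λ P) :=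
  Module.compHom P (Algebra.TensorProduct.includeLeftRingHom : Λ →+* Λ ⊗[k] Λᵐᵒᵖ)

instance : Module Λᵐᵒᵖ (AsBimodule k Λ P) :=
  Module.compHom P
    (Algebra.TensorProduct.includeRight : Λᵐᵒᵖ →ₐ[k] Λ ⊗[k] Λᵐᵒᵖ).toRingHom

/-- The identity map from `P` to the underlying bimodule. -/
def of (k Λ : Type*) {P : Type*} [AddCommGroup P] : P ≃+ AsBimodule k Λ P := AddEquiv.refl P

theorem smul_of (a : Λ) (x : P) : a • of k Λ x = of k Λ ((a ⊗ₜ[k] (1 : Λᵐᵒᵖ)) • x) := rfl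

theorem op_smul_of (b : Λᵐᵒᵖ) (x : P) : b • of k Λ x = of k Λ (((1 : Λ) ⊗ₜ[k] b) • x) := rfl

instance : SMulCommClass Λ Λᵐᵒᵖ (AsBimodule k Λ P) where
  smul_comm a b x := by
    obtain ⟨x, rfl⟩ := (of k Λ).surjective x
    simp only [smul_of, op_smul_of, smul_smul, Algebra.TensorProduct.tmul_mul_tmul, one_mul,
      mul_one]

/-- A homomorphism of `Λ ⊗ Λᵒᵖ`-modules as a left linear map. -/
def map (f : P →ₗ[Λ ⊗[k] Λᵐᵒᵖ] L) : AsBimodule k Λ P →ₗ[Λ] AsBimodule k Λ L where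
  __ := f.toAddMonoidHom
  map_smul' a := f.map_smul (a ⊗ₜ 1)

theorem map_op_smul (f : P →ₗ[Λ ⊗[k] Λᵐᵒᵖ] L) (b : Λᵐᵒᵖ) (x : AsBimodule k Λ P) :
    map f (b • x) = b • map f x := f.map_smul (1 ⊗ₜ b) x

theorem tmul_one_mul (a : Λ) (z : Λ ⊗[k] Λᵐᵒᵖ) : (a ⊗ₜ 1) * z = a • z := by
  conv_rhs => rw [← one_mul z, ← smul_mul_assoc, Algebra.TensorProduct.one_def,
    TensorProduct.smul_tmul', smul_eq_mul, mul_one]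

/-- The free bimodule of rank one as a left `Λ`-module. -/
def freeEquiv (k Λ : Type*) [CommRing k] [Ring Λ] [Algebra k Λ] :
    AsBimodule k Λ (Λ ⊗[k] Λᵐᵒᵖ) ≃ₗ[Λ] Λ ⊗[k] Λᵐᵒᵖ where
  __ := (of k Λ).symm
  map_smul' := tmul_one_mul

instance projective [Module.Free k Λ] [Module.Projective (Λ ⊗[k] Λᵐᵒᵖ) P] :
    Module.Projective Λ (AsBimodule k Λ P) := by
  let _ : Module Λ P := inferInstanceAs (Module Λ (AsBimodule k Λ P))
  have : IsScalarTower Λ (Λ ⊗[k] Λᵐᵒᵖ) P := ⟨fun a z x => by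
    rw [← tmul_one_mul, mul_smul]
    rfl⟩
  obtain ⟨s, hs⟩ := Module.projective_def'.1 ‹Module.Projective (Λ ⊗[k] Λᵐᵒᵖ) P›
  exact Module.Projective.of_split (P := P) (s.restrictScalars Λ)
    ((Finsupp.linearCombination (Λ ⊗[k] Λᵐᵒᵖ) id).restrictScalars Λ)
    (LinearMap.ext fun x => LinearMap.congr_fun hs x)

variable {K : Type*} [AddCommGroup K] [Module (Λ ⊗[k] Λᵐᵒᵖ) K]
  {i : K →ₗ[Λ ⊗[k] Λᵐᵒᵖ] P} {f : P →ₗ[Λ ⊗[k] Λᵐᵒᵖ] L}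

theorem exists_retraction [Module.Projective Λ (AsBimodule k Λ L)] (hi : Function.Injective i)
    (hif : Function.Exact i f) (hf : Function.Surjective f) :
    ∃ r : AsBimodule k Λ P →ₗ[Λ] AsBimodule k Λ K, r ∘ₗ map i = LinearMap.id :=
  have exact : Function.Exact (map i) (map f) := hif
  ((exact.split_tfae hi hf).out 0 1).1
    (Module.projective_lifting_property (map f) LinearMap.id hf)

theorem projective_of_exact [Module.Projective Λ (AsBimodule k Λ P)]
    [Module.Projective Λ (AsBimodule k Λ L)] (hi : Function.Injective i)
    (hif : Function.Exact i f) (hf : Function.Surjective f) :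
    Module.Projective Λ (AsBimodule k Λ K) :=
  have ⟨r, hr⟩ := exists_retraction hi hif hf
  .of_split (map i) r hr

end AsBimodule

/-- The left linear maps from the bimodule `P` to the `Λ`-module `N`. They form a left `Λ`-module
by `(b • f) x = f (x * b)`. -/
abbrev LeftHom (k Λ P N : Type*) [CommRing k] [Ring Λ] [Algebra k Λ] [AddCommGroup P]
    [Module (Λ ⊗[k] Λᵐᵒᵖ) P] [AddCommGroup N] [Module Λ N] : Type _ :=
  AsBimodule k Λ P →ₗ[Λ] N

namespace LeftHom

variable {k Λ P L N : Type*} [CommRing k] [Ring Λ] [Algebra k Λ] [AddCommGroup P]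
  [Module (Λ ⊗[k] Λᵐᵒᵖ) P] [AddCommGroup L] [Module (Λ ⊗[k] Λᵐᵒᵖ) L] [AddCommGroup N] [Module Λ N]

-- For commutative `Λ` this competes with the pointwise action on linear maps.
scoped instance : Module Λ (LeftHom k Λ P N) :=
  letI : Module Λᵐᵒᵖᵐᵒᵖ (LeftHom k Λ P N) :=
    inferInstanceAs (Module Λᵐᵒᵖᵈᵐᵃ (AsBimodule k Λ P →ₗ[Λ] N))
  Module.compHom _ (RingEquiv.opOp Λ).toRingHom

theorem smul_apply (b : Λ) (f : LeftHom k Λ P N) (x : AsBimodule k Λ P) :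
    (b • f) x = f (MulOpposite.op b • x) := rfl

/-- Precomposition with a homomorphism of bimodules. -/
def precomp (N : Type*) [AddCommGroup N] [Module Λ N] (f : P →ₗ[Λ ⊗[k] Λᵐᵒᵖ] L) :
    LeftHom k Λ L N →ₗ[Λ] LeftHom k Λ P N where
  toFun g := g ∘ₗ AsBimodule.map f
  map_add' _ _ := rfl
  map_smul' b g := LinearMap.ext fun x => by
    simp only [LinearMap.comp_apply, smul_apply, AsBimodule.map_op_smul, RingHom.id_apply]

/-- Precomposition with an isomorphism of bimodules. -/
def congrEquiv (N : Type*) [AddCommGroup N] [Module Λ N] (e : P ≃ₗ[Λ ⊗[k] Λᵐᵒᵖ] L) :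
    LeftHom k Λ L N ≃ₗ[Λ] LeftHom k Λ P N :=
  .ofLinearMap (precomp N e) (precomp N e.symm)
    (LinearMap.ext fun g => LinearMap.ext fun x => congrArg g (e.symm_apply_apply x))
    (LinearMap.ext fun g => LinearMap.ext fun x => congrArg g (e.apply_symm_apply x))

variable {K : Type*} [AddCommGroup K] [Module (Λ ⊗[k] Λᵐᵒᵖ) K]
  {i : K →ₗ[Λ ⊗[k] Λᵐᵒᵖ] P} {f : P →ₗ[Λ ⊗[k] Λᵐᵒᵖ] L}

theorem precomp_injective (hf : Function.Surjective f) : Function.Injective (precomp N f) :=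
  fun _ _ h => LinearMap.ext (hf.forall.2 (LinearMap.congr_fun h))

theorem precomp_surjective [Module.Projective Λ (AsBimodule k Λ L)] (hi : Function.Injective i)
    (hif : Function.Exact i f) (hf : Function.Surjective f) :
    Function.Surjective (precomp N i) := by
  intro g
  obtain ⟨r, hr⟩ := AsBimodule.exists_retraction hi hif hf
  exact ⟨g ∘ₗ r, (LinearMap.comp_assoc _ _ _).trans (by rw [hr, LinearMap.comp_id])⟩

theorem precomp_exact (hif : Function.Exact i f) (hf : Function.Surjective f) :
    Function.Exact (precomp N f) (precomp N i) := by
  have exact : Function.Exact (AsBimodule.map i) (AsBimodule.map f) := hif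
  intro g
  constructor
  · intro hg
    refine ⟨(LinearMap.range (AsBimodule.map i)).liftQ g (LinearMap.range_le_ker_iff.2 hg) ∘ₗ
      (exact.linearEquivOfSurjective hf).symm.toLinearMap, ?_⟩
    refine LinearMap.ext fun x => ?_
    exact congrArg ((LinearMap.range (AsBimodule.map i)).liftQ g (LinearMap.range_le_ker_iff.2 hg))
      (exact.linearEquivOfSurjective_symm_apply hf x)
  · rintro ⟨g, rfl⟩
    exact LinearMap.ext fun x => by simp [precomp, exact.apply_apply_eq_zero]

variable [Module k N] [IsScalarTower k Λ N] {t : Λ →ₗ[k] k}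

/-- The left linear map `a ⊗ b ↦ t b • a • n`. -/
noncomputable def ofForm (t : Λ →ₗ[k] k) (n : N) : LeftHom k Λ (Λ ⊗[k] Λᵐᵒᵖ) N :=
  LinearMap.toSpanSingleton Λ N n ∘ₗ (TensorProduct.AlgebraTensorModule.rid k Λ Λ).toLinearMap ∘ₗ
    (t ∘ₗ (MulOpposite.opLinearEquiv k).symm.toLinearMap).baseChange Λ ∘ₗ
    (AsBimodule.freeEquiv k Λ).toLinearMap

theorem ofForm_tmul (t : Λ →ₗ[k] k) (n : N) (a : Λ) (b : Λᵐᵒᵖ) :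
    ofForm t n (.of k Λ (a ⊗ₜ b)) = t b.unop • a • n :=
  smul_assoc _ _ _

variable {ι : Type*}

theorem sum_smul_ofForm_tmul (t : Λ →ₗ[k] k) (e : ι → N) (s : Finset ι) (y : ι → Λ) (a : Λ)
    (b : Λᵐᵒᵖ) :
    (∑ j ∈ s, y j • ofForm t (e j)) (.of k Λ (a ⊗ₜ b)) =
      a • ∑ j ∈ s, t (b.unop * y j) • e j := by
  simp only [LinearMap.sum_apply, smul_apply, AsBimodule.op_smul_of, smul_eq_mul,
    Algebra.TensorProduct.tmul_mul_tmul, one_mul, ofForm_tmul, MulOpposite.unop_mul,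
    MulOpposite.unop_op, Finset.smul_sum, smul_comm a]

theorem linearIndependent_ofForm (ht : IsSymmetrizingForm t) {e : ι → N}
    (he : LinearIndependent k e) : LinearIndependent Λ fun j => ofForm t (e j) := by
  refine linearIndependent_iff'.2 fun s y hy j hj => ht.ext fun b => ?_
  have sum_eq_zero := LinearMap.congr_fun hy (.of k Λ (1 ⊗ₜ .op b))
  rw [sum_smul_ofForm_tmul, one_smul, LinearMap.zero_apply] at sum_eq_zero
  rw [mul_zero, map_zero]
  exact linearIndependent_iff'.1 he s _ sum_eq_zero j hj

theorem span_range_ofForm [Finite ι] (ht : IsSymmetrizingForm t) (e : Module.Basis ι k N) :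
    Submodule.span Λ (Set.range fun j => ofForm t (e j)) = ⊤ := by
  cases nonempty_fintype ι
  refine eq_top_iff.2 fun f _ => (Submodule.mem_span_range_iff_exists_fun Λ).2 ?_
  let φ : Λ →ₗ[k] N := TensorProduct.AlgebraTensorModule.curry
    (f ∘ₗ (AsBimodule.freeEquiv k Λ).symm.toLinearMap) 1 ∘ₗ
      (MulOpposite.opLinearEquiv k).toLinearMap
  choose y hy using fun j => ht.exists_apply_mul_eq (e.coord j ∘ₗ φ)
  refine ⟨y, LinearMap.ext fun z => ?_⟩
  obtain ⟨z, rfl⟩ := (AsBimodule.of k Λ).surjective z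
  induction z with
  | zero => simp only [map_zero]
  | add z w hz hw => simp only [map_add, hz, hw]
  | tmul a b =>
    calc _ = a • ∑ j, e.repr (φ b.unop) j • e j := by
          simp only [sum_smul_ofForm_tmul, hy, LinearMap.comp_apply, Module.Basis.coord_apply]
      _ = a • f (.of k Λ (1 ⊗ₜ b)) := by rw [e.sum_repr]; rfl
      _ = f (.of k Λ (a ⊗ₜ b)) := by
          rw [← map_smul, AsBimodule.smul_of, smul_eq_mul, Algebra.TensorProduct.tmul_mul_tmul,
            mul_one, one_mul]

/-- The basis of `Hom(Λ ⊗ Λᵒᵖ, N)` given by a symmetrizing form and a `k`-basis of `N`. -/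
noncomputable def basisOfForm [Finite ι] (ht : IsSymmetrizingForm t) (e : Module.Basis ι k N) :
    Module.Basis ι Λ (LeftHom k Λ (Λ ⊗[k] Λᵐᵒᵖ) N) :=
  .mk (linearIndependent_ofForm ht e.linearIndependent) (span_range_ofForm ht e).ge

theorem finite_projective [Module.Free k N] [Module.Finite k N] [Module.Finite (Λ ⊗[k] Λᵐᵒᵖ) P]
    [Module.Projective (Λ ⊗[k] Λᵐᵒᵖ) P] (ht : IsSymmetrizingForm t) :
    Module.Finite Λ (LeftHom k Λ P N) ∧ Module.Projective Λ (LeftHom k Λ P N) := by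
  obtain ⟨n, ⟨B⟩⟩ := FiniteDualBasis.exists_of_finite_projective (Λ ⊗[k] Λᵐᵒᵖ) P
  let basis := basisOfForm ht (Module.Free.chooseBasis k N)
  have := Module.Finite.of_basis basis
  have := Module.Free.of_basis basis
  let restrict : LeftHom k Λ P N →ₗ[Λ] Fin n → LeftHom k Λ (Λ ⊗[k] Λᵐᵒᵖ) N :=
    LinearMap.pi fun i => precomp N (LinearMap.toSpanSingleton _ P (B.vec i))
  let glue : (Fin n → LeftHom k Λ (Λ ⊗[k] Λᵐᵒᵖ) N) →ₗ[Λ] LeftHom k Λ P N :=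
    ∑ i, precomp N (B.coord i) ∘ₗ LinearMap.proj i
  have glue_comp_restrict : glue ∘ₗ restrict = LinearMap.id := by
    refine LinearMap.ext fun f => LinearMap.ext fun x => ?_
    obtain ⟨x, rfl⟩ := (AsBimodule.of k Λ).surjective x
    calc (glue ∘ₗ restrict) f (.of k Λ x)
        = ∑ i, f (.of k Λ (B.coord i x • B.vec i)) := by
          simp only [glue, LinearMap.comp_apply, LinearMap.sum_apply]
          rfl
      _ = f (.of k Λ x) := by rw [← map_sum, ← map_sum, B.sum_coord_smul_vec]
  exact ⟨.of_surjective glue (LinearMap.surjective_of_comp_eq_id _ _ glue_comp_restrict),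
    .of_split restrict glue glue_comp_restrict⟩

end LeftHom
end Bimodule

section RegularBimodule

variable (k : Type u) (Λ : Type v) [Field k] [Ring Λ] [Algebra k Λ]

/-- The identity map from `Λ` to its regular bimodule. -/
def toRegularBimodule : Λ ≃+ regularBimodule k Λ := AddEquiv.refl Λ

theorem tmul_smul_toRegularBimodule (a b x : Λ) :
    (a ⊗ₜ[k] MulOpposite.op b) • toRegularBimodule k Λ x = toRegularBimodule k Λ (a * (x * b)) :=
  rfl

/-- The regular bimodule as a left module. -/
def regularBimoduleEquiv : Λ ≃ₗ[Λ] AsBimodule k Λ (regularBimodule k Λ) where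
  __ := (toRegularBimodule k Λ).trans (AsBimodule.of k Λ)
  map_smul' a x := by
    have := tmul_smul_toRegularBimodule k Λ a 1 x
    rw [mul_one] at this
    exact congrArg (AsBimodule.of k Λ (P := regularBimodule k Λ)) this.symm

instance projective_regularBimodule : Module.Projective Λ (AsBimodule k Λ (regularBimodule k Λ)) :=
  .of_equiv (regularBimoduleEquiv k Λ)

instance finite_regularBimodule : Module.Finite (Λ ⊗[k] Λᵐᵒᵖ) (regularBimodule k Λ) :=
  .of_surjective (LinearMap.toSpanSingleton (Λ ⊗[k] Λᵐᵒᵖ) _ (toRegularBimodule k Λ 1)) fun x => by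
    obtain ⟨x, rfl⟩ := (toRegularBimodule k Λ).surjective x
    refine ⟨x ⊗ₜ MulOpposite.op 1, ?_⟩
    rw [LinearMap.toSpanSingleton_apply, tmul_smul_toRegularBimodule, mul_one, mul_one]

namespace LeftHom

/-- Evaluation at `1`. -/
def regularEquiv (N : Type*) [AddCommGroup N] [Module Λ N] :
    LeftHom k Λ (regularBimodule k Λ) N ≃ₗ[Λ] N where
  __ := (LinearEquiv.congrLeft N ℤ (regularBimoduleEquiv k Λ).symm).toAddEquiv.trans
    (LinearMap.ringLmapEquivSelf Λ ℤ N).toAddEquiv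
  map_smul' b f := by
    calc f (MulOpposite.op b • .of k Λ (toRegularBimodule k Λ 1))
        = f (b • .of k Λ (toRegularBimodule k Λ 1)) := by
          rw [AsBimodule.op_smul_of, AsBimodule.smul_of, ← MulOpposite.op_one,
            tmul_smul_toRegularBimodule, tmul_smul_toRegularBimodule, one_mul, one_mul, mul_one,
            mul_one]
      _ = b • f (.of k Λ (toRegularBimodule k Λ 1)) := f.map_smul b _

end LeftHom

end RegularBimodule

section Periodic

variable {k : Type u} {Λ : Type v} [Field k] [Ring Λ] [Algebra k Λ] {t : Λ →ₗ[k] k}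

theorem IsProjectiveCover.finite {R : Type u} [Ring R] {P M : Type v} [AddCommGroup P]
    [Module R P] [AddCommGroup M] [Module R M] [Module.Finite R M] {f : P →ₗ[R] M}
    (hf : IsProjectiveCover f) : Module.Finite R P := by
  have := hf.projective
  obtain ⟨n, g, hg⟩ := Module.Finite.exists_fin' R M
  obtain ⟨g', rfl⟩ := Module.projective_lifting_property f g hf.surjective
  refine .of_surjective g' (LinearMap.range_eq_top.1 (hf.superfluous _ ?_))
  refine eq_top_iff.2 fun x _ => ?_
  obtain ⟨y, hy⟩ := hg (f x)
  exact Submodule.mem_sup.2 ⟨g' y, ⟨y, rfl⟩, x - g' y, by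
    rw [LinearMap.mem_ker, map_sub, sub_eq_zero, ← hy, LinearMap.comp_apply], add_sub_cancel _ _⟩

open scoped LeftHom ModuleCat

theorem IsSymmetrizingForm.isCosyzygy_leftHom (ht : IsSymmetrizingForm t) [FiniteDimensional k Λ]
    (N : ModuleCat.{v} Λ) [Module.Finite Λ N] {n : ℕ} {L X : ModuleCat.{v} (Λ ⊗[k] Λᵐᵒᵖ)}
    [Module.Finite (Λ ⊗[k] Λᵐᵒᵖ) L] [Module.Projective Λ (AsBimodule k Λ L)]
    (h : IsMinimalSyzygy n L X) :
    IsCosyzygy n (ModuleCat.of Λ (LeftHom k Λ L N)) (ModuleCat.of Λ (LeftHom k Λ X N)) := by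
  induction n generalizing L with
  | zero =>
    obtain ⟨e⟩ := h
    exact ⟨(LeftHom.congrEquiv N e.toLinearEquiv).toModuleIso⟩
  | succ n ih =>
    obtain ⟨P, f, hf, h⟩ := h
    have := hf.projective
    have := hf.finite
    have : IsNoetherianRing (Λ ⊗[k] Λᵐᵒᵖ) := .of_finite k _
    have : Module.Finite k N := .trans Λ N
    have exact := LeftHom.precomp_exact (N := N) f.exact_subtype_ker_map hf.surjective
    obtain ⟨_, _⟩ := LeftHom.finite_projective (P := P) (N := N) ht
    have : Module.Projective Λ (AsBimodule k Λ (LinearMap.ker f)) :=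
      AsBimodule.projective_of_exact Subtype.val_injective f.exact_subtype_ker_map hf.surjective
    refine ⟨.of Λ (LeftHom k Λ P N), .of Λ (LeftHom k Λ (LinearMap.ker f) N),
      ModuleCat.ofHom (LeftHom.precomp N f), ModuleCat.ofHom (LeftHom.precomp N _),
      ModuleCat.hom_ext exact.linearMap_comp_eq_zero, ‹_›, ‹_›,
      ModuleCat.shortComplex_shortExact _ exact (LeftHom.precomp_injective hf.surjective)
        (LeftHom.precomp_surjective Subtype.val_injective f.exact_subtype_ker_map hf.surjective),
      ih h⟩

theorem IsPeriodicAlgebra.exists_isCosyzygy_self [FiniteDimensional k Λ]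
    (hper : IsPeriodicAlgebra k Λ) (ht : IsSymmetrizingForm t)
    (N : ModuleCat.{v} Λ) [Module.Finite Λ N] : ∃ p : ℕ, 0 < p ∧ IsCosyzygy p N N := by
  obtain ⟨p, hp, h⟩ := hper
  let e : ModuleCat.of Λ (LeftHom k Λ (regularBimodule k Λ) N) ≅ N :=
    (LeftHom.regularEquiv k Λ N).toModuleIso
  exact ⟨p, hp, ((ht.isCosyzygy_leftHom N h).of_iso_right e).of_iso_left e.symm⟩

end Periodic

theorem mainTheorem2_general {k : Type u} {Λ : Type v} [Field k] [Ring Λ] [Algebra k Λ]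
    [FiniteDimensional k Λ] (hsymm : IsSymmAlgebra k Λ) (hper : IsPeriodicAlgebra k Λ)
    (M N : ModuleCat.{v} Λ) [Module.Finite Λ N] :
    List.TFAE [
      ∃ n : ℕ, ∀ i : ℕ, n ≤ i → Subsingleton (Abelian.Ext M N i),
      ∀ i : ℕ, 0 < i → Subsingleton (Abelian.Ext M N i),
      ∃ n : ℕ, ∀ i : ℕ, n ≤ i → Subsingleton (Abelian.Ext N M i),
      ∀ i : ℕ, 0 < i → Subsingleton (Abelian.Ext N M i)] := by
  obtain ⟨t, ht⟩ := hsymm.exists_isSymmetrizingForm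
  obtain ⟨p, hp, hN⟩ := hper.exists_isCosyzygy_self ht N
  exact ht.tfae_subsingleton_ext hp hN M

theorem mainTheorem2 (k : Type u) (Λ : Type v) [Field k] [Ring Λ] [Algebra k Λ]
    [FiniteDimensional k Λ]
    (hsymm : IsSymmAlgebra k Λ) (hper : IsPeriodicAlgebra k Λ)
    (hss : IsSemisimpleRing ((Λ ⧸ Ring.jacobson Λ) ⊗[k] (Λ ⧸ Ring.jacobson Λ)))
    (M N : ModuleCat.{v} Λ) [Module.Finite Λ M] [Module.Finite Λ N] :
    List.TFAE [
      ∃ n : ℕ, ∀ i : ℕ, n ≤ i → Subsingleton (Abelian.Ext M N i),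
      ∀ i : ℕ, 0 < i → Subsingleton (Abelian.Ext M N i),
      ∃ n : ℕ, ∀ i : ℕ, n ≤ i → Subsingleton (Abelian.Ext N M i),
      ∀ i : ℕ, 0 < i → Subsingleton (Abelian.Ext N M i)] :=
  mainTheorem2_general hsymm hper M N
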